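/- **Setting.** Let $c\ge 1$ be an integer, $\beta>0$, and let $(b_j)_{j\ge 0}$, $(h_j)_{j\ge 1}$ be real numbers with $b_j\ge 0$ for $j\ne 1$, $h_j\ge0$ for $j\ge 1$, $0<-b_1=\sum_{j\ne 1}b_j<\infty$, $b_0>0$, $\sum_{j\ge 2}b_j>0$ and $0<h:=\sum_{j\ge1}h_j<\infty$. Let $Q^*=(q^*_{ij})_{i,j\ge 0}$ be given by $q^*_{i,i-1}=\min(i,c)b_0$, $q^*_{ii}=b_1-(\min(i,c)-1)b_0$ and $q^*_{ij}=b_{j-i+1}$ $(j>i)$ for $i\ge 1$, all other entries being $0$. Let $Q=Q^*+Q_s+Q_d$, where $Q_s$ has the entries $q^{(s)}_{00}=-h$, $q^{(s)}_{0j}=h_j$ $(j\ge1)$ and $0$ otherwise, and $Q_d$ has the entries $q^{(d)}_{i0}=\beta$, $q^{(d)}_{ii}=-\beta$ $(i\ge1)$ and $0$ otherwise. Let $(p_{ij}(t))$ and $(p^*_{ij}(t))$ be the transition functions of the Feller minimal $Q$-process and $Q^*$-process. Put $$B(s)=\sum_{j\ge0}b_js^j,\quad B_c(s)=B(s)+(c-1)b_0(1-s),\quad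 U_\beta(s)=B_c(s)-\beta s,\quad H(s)=\sum_{j\ge1}h_js^j,$$ $$L_j(\beta)=\sum_{i\ge1}h_i\int_0^\infty e^{-\beta t}p^*_{ij}(t)\,dt ,$$ and let $u(\beta)$ be the root of $U_\beta$ on $[0,1]$. **Theorem.** The root $u(\beta)$ lies in $(0,1)$ and is the only root of $U_\beta$ on $[-1,1]$. The $Q$-process has an equilibrium distribution $(\pi_j)_{j\ge0}$, that is, a unique stationary probability distribution $(\pi_j)$, and $p_{ij}(t)\to\pi_j$ as $t\to\infty$ for all $i,j\ge0$. Its generating function $\Pi(s)=\sum_{k\ge0}\pi_ks^k$ satisfies, for all $s\in[-1,1]$ with $s\neq u(\beta)$, $$\Pi(s)=\pi_0\Big[1+\frac{s(H(u(\beta))-H(s))}{U_\beta(s)}\Big]+\frac{\sum_{k=1}^{c-1}\pi_k(c-k)b_0\big[s^k(1-s)-s\,u(\beta)^{k-1}(1-u(\beta))\big]}{U_\beta(s)} .$$ Furthermore, $$\pi_0=\beta\Big[\beta+h-H(u(\beta))+\sum_{k=1}^{c-1}L_k(\beta)u(\beta)^{k-1}(c-k)b_0(1-u(\beta))\Big]^{-1},\qquad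 \pi_j=\pi_0L_j(\beta)\quad(j\ge1).$$ -/

import Mathlib

open Set Filter Topology MeasureTheory
open scoped ENNReal

namespace MXMc

noncomputable section

/-! ### The `q`-matrices of the queue

States are natural numbers. The data are the number `c` of servers, a sequence `b`, a sequence
`h` (only the values `h j` with `j ≥ 1` are ever used), and the catastrophe rate `β`. -/

/-- The `q`-matrix `Q*` of the queue stopped when it becomes empty. -/
def qStar (c : ℕ) (b : ℕ → ℝ) (i j : ℕ) : ℝ :=
  if i = 0 then 0
  else if j + 1 = i then ((min i c : ℕ) : ℝ) * b 0
  else if j = i then b 1 - (((min i c : ℕ) : ℝ) - 1) * b 0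
  else if i < j then b (j - i + 1)
  else 0

/-- The total resurrection rate `h = ∑_{j ≥ 1} h_j`. -/
def hTotal (h : ℕ → ℝ) : ℝ := ∑' j : ℕ, h (j + 1)

/-- The `q`-matrix `Q_s` of the resurrection at the empty state. -/
def qRes (h : ℕ → ℝ) (i j : ℕ) : ℝ :=
  if i = 0 then (if j = 0 then -hTotal h else h j) else 0

/-- The `q`-matrix `Q_d` of the catastrophes. -/
def qCat (β : ℝ) (i j : ℕ) : ℝ :=
  if i = 0 then 0
  else if j = 0 then β
  else if j = i then -β
  else 0

/-- The `q`-matrix `Q = Q* + Q_s + Q_d` of the queue with resurrection and catastrophes. -/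
def qMatrix (c : ℕ) (b h : ℕ → ℝ) (β : ℝ) (i j : ℕ) : ℝ :=
  qStar c b i j + qRes h i j + qCat β i j

/-! ### The Feller minimal process of a `q`-matrix -/

/-- Feller's iteration for the backward integral equation of a `q`-matrix `Q`:
the `n`-th iterate is the probability to be in `j` at time `t`, starting from `i`, after fewer than
`n` jumps. -/
def fellerIter (Q : ℕ → ℕ → ℝ) : ℕ → ℝ → ℕ → ℕ → ℝ≥0∞
  | 0, _, _, _ => 0
  | n + 1, t, i, j =>
      (if i = j then ENNReal.ofReal (Real.exp (Q i i * t)) else 0) +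
        ∫⁻ s in Icc (0 : ℝ) t, ENNReal.ofReal (Real.exp (Q i i * s)) *
          ∑' k : ℕ, if k = i then 0 else ENNReal.ofReal (Q i k) * fellerIter Q n (t - s) k j

/-- The transition function `p_ij(t)` (`t ≥ 0`) of the Feller minimal `Q`-process: the limit of the
nondecreasing sequence of Feller's iterates. -/
def transition (Q : ℕ → ℕ → ℝ) (t : ℝ) (i j : ℕ) : ℝ :=
  (⨆ n : ℕ, fellerIter Q n t i j).toReal

/-- The resolvent `∫_0^∞ e^{-λ t} p_ij(t) dt` of the Feller minimal `Q`-process. -/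
def resolvent (Q : ℕ → ℕ → ℝ) (lam : ℝ) (i j : ℕ) : ℝ :=
  ∫ t in Ioi (0 : ℝ), Real.exp (-(lam * t)) * transition Q t i j

/-- `π` is a stationary probability distribution of the transition function `P`. -/
structure IsStationaryDistribution (P : ℝ → ℕ → ℕ → ℝ) (π : ℕ → ℝ) : Prop where
  nonneg : ∀ j, 0 ≤ π j
  hasSum_one : HasSum π 1
  invariant : ∀ t : ℝ, 0 ≤ t → ∀ j, HasSum (fun i => π i * P t i j) (π j)

/-- `π` is the equilibrium distribution of the transition function `P`: it is the only stationary
probability distribution, and the limit law from every initial state. -/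
structure IsEquilibriumDistribution (P : ℝ → ℕ → ℕ → ℝ) (π : ℕ → ℝ) : Prop where
  stationary : IsStationaryDistribution P π
  unique : ∀ ν : ℕ → ℝ, IsStationaryDistribution P ν → ν = π
  limit : ∀ i j, Tendsto (fun t => P t i j) atTop (𝓝 (π j))

/-! ### Generating functions and the quantities `u(λ)`, `L_j(λ)` -/

/-- `B(s) = ∑_{j ≥ 0} b_j s^j`. -/
def genB (b : ℕ → ℝ) (s : ℝ) : ℝ := ∑' j : ℕ, b j * s ^ j

/-- `B_i(s) = B(s) + (i - 1) b_0 (1 - s)`. -/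
def genBi (b : ℕ → ℝ) (i : ℕ) (s : ℝ) : ℝ := genB b s + ((i : ℝ) - 1) * b 0 * (1 - s)

/-- `H(s) = ∑_{j ≥ 1} h_j s^j`. -/
def genH (h : ℕ → ℝ) (s : ℝ) : ℝ := ∑' j : ℕ, h (j + 1) * s ^ (j + 1)

/-- `U_λ(s) = B_c(s) - λ s`. -/
def genU (c : ℕ) (b : ℕ → ℝ) (lam s : ℝ) : ℝ := genBi b c s - lam * s

/-- `u(λ)`, the root of `U_λ` on `[0, 1]`, here taken as the smallest one. -/
def rootU (c : ℕ) (b : ℕ → ℝ) (lam : ℝ) : ℝ :=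
  sInf {s : ℝ | s ∈ Icc (0 : ℝ) 1 ∧ genU c b lam s = 0}

/-- `L_j(λ) = ∑_{i ≥ 1} h_i φ*_ij(λ)`, with `φ*` the resolvent of the `Q*`-process. -/
def bigL (c : ℕ) (b h : ℕ → ℝ) (lam : ℝ) (j : ℕ) : ℝ :=
  ∑' i : ℕ, h (i + 1) * resolvent (qStar c b) lam (i + 1) j

end

end MXMc

open MXMc

namespace MXMc

/-! ### The space `ℓ¹` -/

/-! All rates are bounded, so each `q`-matrix acts on row vectors as a bounded operator on `ℓ¹`, and
its Feller minimal process is the norm-convergent exponential `exp (tQ)` (`transition_eq`).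
Questions about the process thus become linear algebra on `ℓ¹`.

Write `Q'` for `Q* + Q_s`. Catastrophes change `xQ'` into `xQ' - βx + β (mass x) e₀`. On vectors of
mass zero the rank-one term disappears, so `exp (tQ)` is there `e^{-βt} exp (tQ')`, of norm at most
`e^{-βt}` (`semi_apply_of_mass_eq_zero`). The difference of two probability vectors has mass zero,
so one stationary vector suffices for uniqueness and convergence.

Such a vector comes from the resolvent identity `y Q* = βy - (h_j)` for `y = (L_j(β))`: overwriting
`y₀` by `1` gives a vector whose image under `Q` is a multiple of `e₀` and has mass zero, hence
vanishes (`exists_gen_eq_zero`).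

Pairing `πQ = 0` with the powers of `s` yields a functional equation for `Π` (`genFun_stationary`).
At `s = u(β)` the coefficient `U_β` vanishes, leaving a linear relation between `π₀` and the
boundary terms; it gives both the stated form of `Π` and the value of `π₀`. Location and uniqueness
of the root rest on convexity of `B` on `[0, 1]` and positivity of `U_β` on `[-1, 0]`
(`rootU_spec`). -/

/-- Summable real sequences. -/
abbrev L1 : Type := lp (fun _ : ℕ => ℝ) 1

/-- The `i`-th unit vector. -/
noncomputable def unitVec (i : ℕ) : L1 := lp.single 1 i 1

lemma unitVec_apply (i j : ℕ) : unitVec i j = if i = j then 1 else 0 := by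
  rw [unitVec, lp.single_apply, Pi.single_apply]
  simp [eq_comm]

lemma norm_unitVec (i : ℕ) : ‖unitVec i‖ = 1 := by
  simp [unitVec, lp.norm_single]

lemma hasSum_unitVec (x : L1) : HasSum (fun i => x i • unitVec i) x := by
  have := lp.hasSum_single (p := 1) (by simp) x
  convert this using 2 with i
  rw [unitVec, ← lp.single_smul]
  simp

lemma hasSum_abs (x : L1) : HasSum (fun i => |x i|) ‖x‖ := by
  have := lp.hasSum_norm (p := 1) (by simp) x
  simpa using this

/-- A summable sequence as an element of `ℓ¹`. -/
noncomputable def ofSummable (f : ℕ → ℝ) (hf : Summable f) : L1 :=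
  ⟨f, memℓp_gen (by simpa using hf.abs)⟩

@[simp] lemma ofSummable_apply (f : ℕ → ℝ) (hf : Summable f) (i : ℕ) : ofSummable f hf i = f i :=
  rfl

section Operators

variable {F : Type*} [NormedAddCommGroup F] [NormedSpace ℝ F]

lemma hasSum_map (T : L1 →L[ℝ] F) (x : L1) : HasSum (fun i => x i • T (unitVec i)) (T x) := by
  simpa using (hasSum_unitVec x).mapL T

/-- The triangle inequality applied to `x = ∑ x_i e_i`: on `ℓ¹`, operator bounds need only be
checked row by row. -/
lemma norm_map_le (T : L1 →L[ℝ] F) (C : ℝ) (hT : ∀ i, ‖T (unitVec i)‖ ≤ C) (x : L1) :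
    ‖T x‖ ≤ C * ‖x‖ := by
  rw [← (hasSum_map T x).tsum_eq]
  refine tsum_of_norm_bounded ((hasSum_abs x).mul_left C) fun i => ?_
  rw [norm_smul, Real.norm_eq_abs, mul_comm]
  exact mul_le_mul_of_nonneg_right (hT i) (abs_nonneg _)

lemma ext_unitVec {T T' : L1 →L[ℝ] F} (h : ∀ i, T (unitVec i) = T' (unitVec i)) : T = T' := by
  ext1 x
  refine (hasSum_map T x).unique ?_
  simpa only [h] using hasSum_map T' x

variable [CompleteSpace F]

lemma summable_smul_of_bounded (r : ℕ → F) (C : ℝ) (hr : ∀ i, ‖r i‖ ≤ C) (x : L1) :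
    Summable (fun i => x i • r i) := by
  refine Summable.of_norm_bounded ((hasSum_abs x).summable.mul_left C) fun i => ?_
  rw [norm_smul, Real.norm_eq_abs, mul_comm]
  exact mul_le_mul_of_nonneg_right (hr i) (abs_nonneg _)

/-- The operator on `ℓ¹` with prescribed bounded values at the unit vectors. -/
noncomputable def ofRows (r : ℕ → F) (C : ℝ) (hr : ∀ i, ‖r i‖ ≤ C) : L1 →L[ℝ] F :=
  LinearMap.mkContinuous
    { toFun := fun x => ∑' i, x i • r i
      map_add' := fun x y => by
        rw [← (summable_smul_of_bounded r C hr x).tsum_add (summable_smul_of_bounded r C hr y)]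
        exact tsum_congr fun i => by rw [lp.coeFn_add, Pi.add_apply, add_smul]
      map_smul' := fun a x => by
        rw [RingHom.id_apply, ← (summable_smul_of_bounded r C hr x).tsum_const_smul]
        exact tsum_congr fun i => by rw [lp.coeFn_smul, Pi.smul_apply, smul_assoc] }
    C fun x => by
      refine tsum_of_norm_bounded ((hasSum_abs x).mul_left C) fun i => ?_
      rw [norm_smul, Real.norm_eq_abs, mul_comm]
      exact mul_le_mul_of_nonneg_right (hr i) (abs_nonneg _)

lemma ofRows_apply (r : ℕ → F) (C : ℝ) (hr : ∀ i, ‖r i‖ ≤ C) (x : L1) :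
    ofRows r C hr x = ∑' i, x i • r i := rfl

lemma ofRows_unitVec (r : ℕ → F) (C : ℝ) (hr : ∀ i, ‖r i‖ ≤ C) (i : ℕ) :
    ofRows r C hr (unitVec i) = r i := by
  rw [ofRows_apply, tsum_eq_single i]
  · simp [unitVec_apply]
  · intro j hj
    simp [unitVec_apply, hj.symm]

end Operators

/-- The `j`-th coordinate functional. -/
noncomputable def coord (j : ℕ) : L1 →L[ℝ] ℝ :=
  LinearMap.mkContinuous
    { toFun := fun x => x j
      map_add' := fun _ _ => rfl
      map_smul' := fun _ _ => rfl } 1 fun x => by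
      rw [one_mul]
      exact lp.norm_apply_le_norm (p := 1) (by simp) x j

@[simp] lemma coord_apply (j : ℕ) (x : L1) : coord j x = x j := rfl

/-- The generating function at `s ∈ [-1, 1]` as a functional on `ℓ¹`. -/
noncomputable def genFun (s : ℝ) (hs : |s| ≤ 1) : L1 →L[ℝ] ℝ :=
  ofRows (fun j => s ^ j) 1 fun j => by
    rw [norm_pow]; exact pow_le_one₀ (norm_nonneg _) hs

lemma hasSum_genFun (s : ℝ) (hs : |s| ≤ 1) (x : L1) :
    HasSum (fun j => x j * s ^ j) (genFun s hs x) := by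
  simpa [genFun, ofRows_unitVec] using hasSum_map (genFun s hs) x

/-- The total mass of a summable sequence. -/
noncomputable def mass : L1 →L[ℝ] ℝ := genFun 1 (by simp)

lemma hasSum_mass (x : L1) : HasSum (fun j => x j) (mass x) := by
  have h := hasSum_genFun 1 (by simp) x
  simp only [one_pow, mul_one] at h
  exact h

lemma mass_unitVec (i : ℕ) : mass (unitVec i) = 1 := by
  rw [mass, genFun, ofRows_unitVec, one_pow]

lemma norm_eq_mass {x : L1} (hx : ∀ j, 0 ≤ x j) : ‖x‖ = mass x := by
  refine (hasSum_abs x).unique ?_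
  simpa only [abs_of_nonneg (hx _)] using hasSum_mass x

lemma nonneg_unitVec (i j : ℕ) : 0 ≤ unitVec i j := by
  rw [unitVec_apply]; split_ifs <;> norm_num

lemma abs_apply_le_norm (x : L1) (j : ℕ) : |x j| ≤ ‖x‖ :=
  lp.norm_apply_le_norm (p := 1) (by simp) x j

/-! ### Positive operators and exponentials -/

/-- An operator on `ℓ¹` is positive if it maps unit vectors to nonnegative sequences. -/
def IsPos (T : L1 →L[ℝ] L1) : Prop := ∀ i j, 0 ≤ T (unitVec i) j

lemma IsPos.apply_nonneg {T : L1 →L[ℝ] L1} (hT : IsPos T) {x : L1} (hx : ∀ j, 0 ≤ x j) (j : ℕ) :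
    0 ≤ T x j := by
  have h := (hasSum_map T x).mapL (coord j)
  exact h.nonneg fun i => by
    simpa using mul_nonneg (hx i) (hT i j)

lemma IsPos.pow {T : L1 →L[ℝ] L1} (hT : IsPos T) (n : ℕ) : IsPos (T ^ n) := by
  induction n with
  | zero => intro i j; simpa using nonneg_unitVec i j
  | succ n ih =>
    intro i j
    rw [pow_succ, mul_apply_eq_comp]
    exact ih.apply_nonneg (hT i) j

lemma hasSum_exp_apply (T : L1 →L[ℝ] L1) (x : L1) :
    HasSum (fun n : ℕ => ((n.factorial : ℝ)⁻¹) • (T ^ n) x) (NormedSpace.exp T x) := by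
  have h := NormedSpace.exp_series_hasSum_exp' (𝕂 := ℝ) T
  simpa using h.mapL (ContinuousLinearMap.apply ℝ L1 x)

lemma IsPos.exp {T : L1 →L[ℝ] L1} (hT : IsPos T) : IsPos (NormedSpace.exp T) := by
  intro i j
  have h := (hasSum_exp_apply T (unitVec i)).mapL (coord j)
  exact h.nonneg fun n => by
    simpa using mul_nonneg (by positivity) (hT.pow n i j)

/-- Only the orbit of `x` enters the exponential series, so generators that differ as operators can
be compared along a single vector. -/
lemma exp_apply_eq {T T' : L1 →L[ℝ] L1} {x : L1} (h : ∀ n, (T ^ n) x = (T' ^ n) x) :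
    NormedSpace.exp T x = NormedSpace.exp T' x := by
  refine (hasSum_exp_apply T x).unique ?_
  simpa only [h] using hasSum_exp_apply T' x

lemma exp_apply_of_apply_eq_zero {T : L1 →L[ℝ] L1} {x : L1} (h : T x = 0) :
    NormedSpace.exp T x = x := by
  have : NormedSpace.exp T x = NormedSpace.exp (0 : L1 →L[ℝ] L1) x := exp_apply_eq fun n => by
    cases n with
    | zero => simp
    | succ n => rw [pow_succ, mul_apply_eq_comp, h]; simp [pow_succ]
  simpa using this

/-- Every term of the series after the zeroth lies in the range of `T`. With `φ = mass` this is
conservation of probability. -/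
lemma map_exp_apply_of_comp_eq_zero {T : L1 →L[ℝ] L1} {φ : L1 →L[ℝ] ℝ} (h : ∀ x, φ (T x) = 0)
    (x : L1) : φ (NormedSpace.exp T x) = φ x := by
  refine ((hasSum_exp_apply T x).mapL φ).unique ?_
  convert hasSum_ite_eq (0 : ℕ) (φ x) using 2 with n
  cases n with
  | zero => simp
  | succ n => rw [pow_succ', mul_apply_eq_comp]; simp [h]

lemma exp_add_smul_one (T : L1 →L[ℝ] L1) (a : ℝ) :
    NormedSpace.exp (T + a • (1 : L1 →L[ℝ] L1)) = Real.exp a • NormedSpace.exp T := by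
  have hc : Commute T (a • (1 : L1 →L[ℝ] L1)) := (Commute.one_right T).smul_right a
  let +nondep : NormedAlgebra ℚ (L1 →L[ℝ] L1) := NormedAlgebra.restrictScalars ℚ ℝ _
  rw [NormedSpace.exp_add_of_commute hc]
  have h := NormedSpace.algebraMap_exp_comm (𝕂 := ℝ) (𝔸 := L1 →L[ℝ] L1) a
  rw [Algebra.algebraMap_eq_smul_one, Algebra.algebraMap_eq_smul_one] at h
  rw [← h, mul_smul_comm, mul_one, Real.exp_eq_exp_ℝ]

/-! ### Bounded conservative `q`-matrices -/

/-- `Q` is a conservative `q`-matrix with rates at most `M`. -/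
structure IsBddQ (Q : ℕ → ℕ → ℝ) (M : ℝ) : Prop where
  nonneg : ∀ i j, i ≠ j → 0 ≤ Q i j
  hasSum : ∀ i, HasSum (Q i) 0
  bound : ∀ i, -Q i i ≤ M
  bound_nonneg : 0 ≤ M

namespace IsBddQ

variable {Q : ℕ → ℕ → ℝ} {M : ℝ} (hQ : IsBddQ Q M)

/-- The `i`-th row of `Q`. -/
noncomputable def row (i : ℕ) : L1 := ofSummable (Q i) (hQ.hasSum i).summable

@[simp] lemma row_apply (i j : ℕ) : hQ.row i j = Q i j := rfl

lemma row_add_nonneg (i j : ℕ) : 0 ≤ (hQ.row i + M • unitVec i) j := by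
  rw [lp.coeFn_add, Pi.add_apply, lp.coeFn_smul, Pi.smul_apply, unitVec_apply, row_apply]
  split_ifs with h
  · subst h; simpa using by linarith [hQ.bound i]
  · simpa using hQ.nonneg i j h

lemma mass_row (i : ℕ) : mass (hQ.row i) = 0 := (hasSum_mass _).unique (hQ.hasSum i)

/-- Adding `M` on the diagonal makes the row nonnegative with total mass `M`; removing it again
costs at most another `M`. -/
lemma norm_row_le (i : ℕ) : ‖hQ.row i‖ ≤ 2 * M := by
  have h : ‖hQ.row i + M • unitVec i‖ = M := by
    rw [norm_eq_mass (hQ.row_add_nonneg i), map_add, hQ.mass_row, map_smul, mass_unitVec]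
    simp
  calc ‖hQ.row i‖ = ‖(hQ.row i + M • unitVec i) - M • unitVec i‖ := by rw [add_sub_cancel_right]
    _ ≤ ‖hQ.row i + M • unitVec i‖ + ‖M • unitVec i‖ := norm_sub_le _ _
    _ = 2 * M := by
      rw [h, norm_smul, norm_unitVec, Real.norm_of_nonneg hQ.bound_nonneg]; ring

/-- The generator `x ↦ xQ` on `ℓ¹`. -/
noncomputable def gen : L1 →L[ℝ] L1 := ofRows hQ.row (2 * M) hQ.norm_row_le

lemma gen_unitVec (i : ℕ) : hQ.gen (unitVec i) = hQ.row i := ofRows_unitVec _ _ _ i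

lemma hasSum_gen (x : L1) (j : ℕ) : HasSum (fun i => x i * Q i j) (hQ.gen x j) := by
  simpa [gen_unitVec] using (hasSum_map hQ.gen x).mapL (coord j)

lemma mass_gen (x : L1) : mass (hQ.gen x) = 0 := by
  have h := (hasSum_map hQ.gen x).mapL mass
  simp only [map_smul, gen_unitVec, mass_row, smul_zero] at h
  exact h.unique hasSum_zero

/-- The semigroup `exp (t Q)` on `ℓ¹`. -/
noncomputable def semi (t : ℝ) : L1 →L[ℝ] L1 := NormedSpace.exp (t • hQ.gen)

lemma semi_zero : hQ.semi 0 = 1 := by simp [semi]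

lemma mass_semi (t : ℝ) (x : L1) : mass (hQ.semi t x) = mass x :=
  map_exp_apply_of_comp_eq_zero (fun x => by simp [mass_gen]) x

/-- Uniformisation: `Q + M` has nonnegative entries, and `exp (tQ)` is the positive scalar `e^{-tM}`
times `exp (t(Q + M))`. -/
lemma isPos_semi {t : ℝ} (ht : 0 ≤ t) : IsPos (hQ.semi t) := by
  have h : hQ.semi t =
      Real.exp (-(t * M)) • NormedSpace.exp (t • (hQ.gen + M • (1 : L1 →L[ℝ] L1))) := by
    rw [← exp_add_smul_one, semi]
    congr 1
    module
  rw [h]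
  have h2 : IsPos (t • (hQ.gen + M • (1 : L1 →L[ℝ] L1))) := fun i j => by
    have h3 : (t • (hQ.gen + M • (1 : L1 →L[ℝ] L1))) (unitVec i) =
        t • (hQ.row i + M • unitVec i) := by simp [gen_unitVec]
    rw [h3]
    exact mul_nonneg ht (hQ.row_add_nonneg i j)
  intro i j
  simpa using mul_nonneg (Real.exp_pos _).le (h2.exp i j)

lemma norm_semi_apply_le {t : ℝ} (ht : 0 ≤ t) (x : L1) : ‖hQ.semi t x‖ ≤ ‖x‖ := by
  refine (norm_map_le _ 1 (fun i => ?_) x).trans_eq (one_mul _)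
  rw [norm_eq_mass (hQ.isPos_semi ht i), mass_semi, mass_unitVec]

lemma hasDerivAt_semi (t : ℝ) : HasDerivAt hQ.semi (hQ.semi t * hQ.gen) t :=
  hasDerivAt_exp_smul_const hQ.gen t

lemma hasDerivAt_semi' (t : ℝ) : HasDerivAt hQ.semi (hQ.gen * hQ.semi t) t :=
  hasDerivAt_exp_smul_const' hQ.gen t

lemma continuous_semi : Continuous hQ.semi :=
  continuous_iff_continuousAt.2 fun t => (hQ.hasDerivAt_semi t).continuousAt

end IsBddQ

namespace IsBddQ
variable {Q : ℕ → ℕ → ℝ} {M : ℝ} (hQ : IsBddQ Q M)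

/-! ### The Feller minimal process of a bounded `q`-matrix -/

/-- The `i`-th row of `Q` without its diagonal entry. -/
noncomputable def offRow (i : ℕ) : L1 := hQ.row i - Q i i • unitVec i

lemma offRow_apply (i k : ℕ) : hQ.offRow i k = if k = i then 0 else Q i k := by
  rw [offRow, lp.coeFn_sub, Pi.sub_apply, lp.coeFn_smul, Pi.smul_apply, unitVec_apply, row_apply]
  by_cases h : k = i
  · subst h; simp
  · simp [h, Ne.symm h]

lemma offRow_nonneg (i k : ℕ) : 0 ≤ hQ.offRow i k := by
  rw [offRow_apply]
  split_ifs with h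
  · exact le_rfl
  · exact hQ.nonneg i k (Ne.symm h)

lemma mass_offRow_le (i : ℕ) : mass (hQ.offRow i) ≤ M := by
  rw [offRow, map_sub, mass_row, map_smul, mass_unitVec]
  simpa using hQ.bound i

lemma gen_unitVec_eq (i : ℕ) : hQ.gen (unitVec i) = hQ.offRow i + Q i i • unitVec i := by
  rw [gen_unitVec, offRow, sub_add_cancel]

/-- Duhamel's formula: integrate the derivative of `s ↦ e^{q_ii s} exp ((t - s)Q)` applied to `e_i`;
the diagonal contributions cancel and only the off-diagonal row survives. -/
lemma semi_unitVec_eq_integral (t : ℝ) (i j : ℕ) :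
    hQ.semi t (unitVec i) j = Real.exp (Q i i * t) * unitVec i j +
      ∫ s in (0 : ℝ)..t, Real.exp (Q i i * s) * hQ.semi (t - s) (hQ.offRow i) j := by
  have hd : ∀ s : ℝ, HasDerivAt
      (fun s => Real.exp (Q i i * s) * hQ.semi (t - s) (unitVec i) j)
      (-(Real.exp (Q i i * s) * hQ.semi (t - s) (hQ.offRow i) j)) s := by
    intro s
    have h1 : HasDerivAt (fun s => hQ.semi (t - s)) (-(hQ.semi (t - s) * hQ.gen)) s := by
      have h0 := (hQ.hasDerivAt_semi (t - s)).scomp s ((hasDerivAt_id s).const_sub t)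
      rw [neg_one_smul] at h0
      exact h0
    have h2 := (((coord j).comp (ContinuousLinearMap.apply ℝ L1 (unitVec i))).hasFDerivAt
      (x := hQ.semi (t - s))).comp_hasDerivAt s h1
    have h5 : ((coord j).comp (ContinuousLinearMap.apply ℝ L1 (unitVec i)))
        (-(hQ.semi (t - s) * hQ.gen)) =
        -(hQ.semi (t - s) (hQ.offRow i) j + Q i i * hQ.semi (t - s) (unitVec i) j) := by
      change coord j (-(hQ.semi (t - s) (hQ.gen (unitVec i)))) = _
      rw [gen_unitVec_eq, map_neg, map_add, map_smul, map_add, map_smul, smul_eq_mul]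
      rfl
    rw [h5] at h2
    have h3 : HasDerivAt (fun s => Real.exp (Q i i * s)) (Real.exp (Q i i * s) * Q i i) s := by
      simpa using ((hasDerivAt_id s).const_mul (Q i i)).exp
    refine (h3.mul h2).congr_deriv ?_
    change Real.exp (Q i i * s) * Q i i * hQ.semi (t - s) (unitVec i) j + _ = _
    ring
  have hc : Continuous fun s => -(Real.exp (Q i i * s) * hQ.semi (t - s) (hQ.offRow i) j) := by
    have h1 : Continuous fun s : ℝ => hQ.semi (t - s) :=
      hQ.continuous_semi.comp (by fun_prop)
    have h2 : Continuous fun s : ℝ => hQ.semi (t - s) (hQ.offRow i) j :=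
      ((coord j).comp (ContinuousLinearMap.apply ℝ L1 (hQ.offRow i))).continuous.comp h1
    fun_prop
  have h := intervalIntegral.integral_eq_sub_of_hasDerivAt (a := 0) (b := t) (fun s _ => hd s)
    (hc.intervalIntegrable 0 t)
  rw [intervalIntegral.integral_neg] at h
  simp only [sub_self, sub_zero, semi_zero, mul_zero, Real.exp_zero, one_mul,
    one_apply_eq_self] at h
  linarith

/-- The entries of the semigroup as extended nonnegative numbers. -/
noncomputable def semiENN (t : ℝ) (i j : ℕ) : ℝ≥0∞ := ENNReal.ofReal (hQ.semi t (unitVec i) j)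

lemma ofReal_semi_offRow {t : ℝ} (ht : 0 ≤ t) (i j : ℕ) :
    ENNReal.ofReal (hQ.semi t (hQ.offRow i) j) =
      ∑' k : ℕ, if k = i then 0 else ENNReal.ofReal (Q i k) * hQ.semiENN t k j := by
  have h := (hasSum_map (hQ.semi t) (hQ.offRow i)).mapL (coord j)
  simp only [map_smul, coord_apply, smul_eq_mul] at h
  rw [← h.tsum_eq, ENNReal.ofReal_tsum_of_nonneg
    (fun k => mul_nonneg (hQ.offRow_nonneg i k) (hQ.isPos_semi ht k j)) h.summable]
  refine tsum_congr fun k => ?_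
  rw [ENNReal.ofReal_mul (hQ.offRow_nonneg i k), offRow_apply]
  split_ifs <;> simp [semiENN]

lemma semiENN_backward {t : ℝ} (ht : 0 ≤ t) (i j : ℕ) :
    hQ.semiENN t i j = (if i = j then ENNReal.ofReal (Real.exp (Q i i * t)) else 0) +
      ∫⁻ s in Icc (0 : ℝ) t, ENNReal.ofReal (Real.exp (Q i i * s)) *
        ∑' k : ℕ, if k = i then 0 else ENNReal.ofReal (Q i k) * hQ.semiENN (t - s) k j := by
  have hnn : ∀ s ∈ Icc (0 : ℝ) t,
      0 ≤ Real.exp (Q i i * s) * hQ.semi (t - s) (hQ.offRow i) j := fun s hs =>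
    mul_nonneg (Real.exp_pos _).le
      ((hQ.isPos_semi (sub_nonneg.2 hs.2)).apply_nonneg (hQ.offRow_nonneg i) j)
  have hc : Continuous fun s => Real.exp (Q i i * s) * hQ.semi (t - s) (hQ.offRow i) j := by
    have h1 : Continuous fun s : ℝ => hQ.semi (t - s) :=
      hQ.continuous_semi.comp (by fun_prop)
    have h2 : Continuous fun s : ℝ => hQ.semi (t - s) (hQ.offRow i) j :=
      ((coord j).comp (ContinuousLinearMap.apply ℝ L1 (hQ.offRow i))).continuous.comp h1
    fun_prop
  have hi : ENNReal.ofReal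
      (∫ s in (0 : ℝ)..t, Real.exp (Q i i * s) * hQ.semi (t - s) (hQ.offRow i) j) =
      ∫⁻ s in Icc (0 : ℝ) t, ENNReal.ofReal (Real.exp (Q i i * s)) *
        ∑' k : ℕ, if k = i then 0 else ENNReal.ofReal (Q i k) * hQ.semiENN (t - s) k j := by
    rw [intervalIntegral.integral_of_le ht, ← integral_Icc_eq_integral_Ioc,
      ofReal_integral_eq_lintegral_ofReal (hc.integrableOn_Icc)
        ((ae_restrict_iff' measurableSet_Icc).2 (Eventually.of_forall hnn))]
    refine setLIntegral_congr_fun measurableSet_Icc fun s hs => ?_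
    rw [← hQ.ofReal_semi_offRow (sub_nonneg.2 hs.2), ENNReal.ofReal_mul (Real.exp_pos _).le]
  rw [← hi, semiENN, semi_unitVec_eq_integral, ENNReal.ofReal_add]
  · congr 1
    rw [unitVec_apply]
    split_ifs <;> simp
  · exact mul_nonneg (Real.exp_pos _).le (nonneg_unitVec i j)
  · exact intervalIntegral.integral_nonneg ht hnn

/-- Minimality: `exp (tQ)` is a fixed point of the monotone backward iteration, which starts from
`0`. -/
lemma fellerIter_le_semiENN (n : ℕ) {t : ℝ} (ht : 0 ≤ t) (i j : ℕ) :
    fellerIter Q n t i j ≤ hQ.semiENN t i j := by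
  induction n generalizing t i with
  | zero => simp [fellerIter]
  | succ n ih =>
    rw [semiENN_backward hQ ht, fellerIter]
    refine add_le_add le_rfl ?_
    refine setLIntegral_mono' measurableSet_Icc fun s hs => ?_
    gcongr with k
    split_ifs
    · exact le_rfl
    · gcongr
      exact ih (sub_nonneg.2 hs.2) k

lemma tsum_offDiag_le (hQ : IsBddQ Q M) (i : ℕ) :
    ∑' k : ℕ, (if k = i then 0 else ENNReal.ofReal (Q i k)) ≤ ENNReal.ofReal M := by
  have h := hasSum_mass (hQ.offRow i)
  refine le_trans (le_of_eq ?_) (ENNReal.ofReal_le_ofReal (hQ.mass_offRow_le i))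
  rw [← h.tsum_eq, ENNReal.ofReal_tsum_of_nonneg (hQ.offRow_nonneg i) h.summable]
  refine tsum_congr fun k => ?_
  rw [offRow_apply]
  split_ifs <;> simp

lemma exp_diag_le_one (hQ : IsBddQ Q M) (i : ℕ) {s : ℝ} (hs : 0 ≤ s) :
    ENNReal.ofReal (Real.exp (Q i i * s)) ≤ 1 := by
  have h : 0 ≤ -Q i i := by
    have h1 := (hasSum_mass (hQ.offRow i)).nonneg (hQ.offRow_nonneg i)
    rw [offRow, map_sub, mass_row, map_smul, mass_unitVec] at h1
    simpa using h1
  rw [← ENNReal.ofReal_one]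
  refine ENNReal.ofReal_le_ofReal (Real.exp_le_one_iff.2 ?_)
  nlinarith

/-- Picard remainder estimate: each step integrates the previous error against a total jump rate of
at most `M`. The error vanishes in the limit, so the iterates exhaust `exp (tQ)`. -/
lemma semiENN_le_fellerIter_add (n : ℕ) {t : ℝ} (ht : 0 ≤ t) (i j : ℕ) :
    hQ.semiENN t i j ≤
      fellerIter Q n t i j + ENNReal.ofReal ((M * t) ^ n / (n.factorial : ℝ)) := by
  have hM := hQ.bound_nonneg
  induction n generalizing t i with
  | zero =>
    simp only [fellerIter, pow_zero, Nat.factorial_zero, Nat.cast_one, div_one, zero_add, semiENN]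
    refine ENNReal.ofReal_le_ofReal ((le_abs_self _).trans ((abs_apply_le_norm _ j).trans ?_))
    exact (hQ.norm_semi_apply_le ht _).trans_eq (norm_unitVec i)
  | succ n ih =>
    rw [semiENN_backward hQ ht, fellerIter, add_assoc]
    refine add_le_add le_rfl ?_
    set a : ℝ → ℝ := fun r => (M * r) ^ n / (n.factorial : ℝ) with ha
    have hint : ENNReal.ofReal ((M * t) ^ (n + 1) / ((n + 1).factorial : ℝ)) =
        ∫⁻ s in Icc (0 : ℝ) t, ENNReal.ofReal (M * a (t - s)) := by
      have hc : Continuous fun s => M * a (t - s) := by fun_prop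
      rw [← ofReal_integral_eq_lintegral_ofReal hc.integrableOn_Icc
        ((ae_restrict_iff' measurableSet_Icc).2 (Eventually.of_forall fun s hs => by
          have : 0 ≤ t - s := sub_nonneg.2 hs.2
          simp only [Pi.zero_apply, ha]; positivity)),
        integral_Icc_eq_integral_Ioc, ← intervalIntegral.integral_of_le ht,
        intervalIntegral.integral_comp_sub_left (fun r => M * a r) t]
      congr 1
      simp only [ha, sub_self, sub_zero, mul_pow]
      simp only [mul_div_right_comm, ← mul_assoc, intervalIntegral.integral_const_mul,
        integral_pow]
      rw [Nat.factorial_succ]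
      have : (n.factorial : ℝ) ≠ 0 := by positivity
      push_cast
      field_simp
      rw [pow_succ' t, pow_succ' M]
      ring
    rw [hint, ← lintegral_add_right _ (by fun_prop)]
    refine setLIntegral_mono' measurableSet_Icc fun s hs => ?_
    have hts : 0 ≤ t - s := sub_nonneg.2 hs.2
    have ha0 : 0 ≤ a (t - s) := by simp only [ha]; positivity
    calc _ ≤ ENNReal.ofReal (Real.exp (Q i i * s)) *
          ((∑' k : ℕ, if k = i then 0 else ENNReal.ofReal (Q i k) * fellerIter Q n (t - s) k j) +
            ∑' k : ℕ, (if k = i then 0 else ENNReal.ofReal (Q i k)) *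
              ENNReal.ofReal (a (t - s))) := by
          rw [← ENNReal.tsum_add]
          gcongr with k
          split_ifs
          · simp
          · rw [← mul_add]
            gcongr
            exact ih hts k
      _ ≤ _ := by
          rw [mul_add]
          refine add_le_add le_rfl ?_
          rw [ENNReal.tsum_mul_right, ENNReal.ofReal_mul hM]
          calc _ ≤ 1 * (ENNReal.ofReal M * ENNReal.ofReal (a (t - s))) := by
                gcongr
                · exact hQ.exp_diag_le_one i hs.1
                · exact hQ.tsum_offDiag_le i
            _ = _ := one_mul _

lemma iSup_fellerIter {t : ℝ} (ht : 0 ≤ t) (i j : ℕ) :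
    ⨆ n, fellerIter Q n t i j = hQ.semiENN t i j := by
  refine le_antisymm (iSup_le fun n => hQ.fellerIter_le_semiENN n ht i j) ?_
  have h : Tendsto (fun n : ℕ => (⨆ n, fellerIter Q n t i j) +
      ENNReal.ofReal ((M * t) ^ n / (n.factorial : ℝ))) atTop
      (𝓝 ((⨆ n, fellerIter Q n t i j) + ENNReal.ofReal 0)) :=
    tendsto_const_nhds.add (ENNReal.tendsto_ofReal
      (FloorSemiring.tendsto_pow_div_factorial_atTop (M * t)))
  rw [ENNReal.ofReal_zero, add_zero] at h
  exact ge_of_tendsto' h fun n => (hQ.semiENN_le_fellerIter_add n ht i j).trans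
    (add_le_add_left (le_iSup (fun n => fellerIter Q n t i j) n) _)

/-- The Feller minimal process of a bounded conservative `q`-matrix is `exp (t Q)`. -/
theorem transition_eq {t : ℝ} (ht : 0 ≤ t) (i j : ℕ) :
    transition Q t i j = hQ.semi t (unitVec i) j := by
  rw [transition, hQ.iSup_fellerIter ht, semiENN, ENNReal.toReal_ofReal (hQ.isPos_semi ht i j)]

end IsBddQ

/-! ### Equilibrium in the presence of catastrophes -/

namespace IsBddQ
variable {Q Q' : ℕ → ℕ → ℝ} {M M' β : ℝ} (hQ : IsBddQ Q M) (hQ' : IsBddQ Q' M')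

lemma semi_apply_of_gen_eq_zero {x : L1} (hx : hQ.gen x = 0) (t : ℝ) : hQ.semi t x = x :=
  exp_apply_of_apply_eq_zero (by simp [hx])

lemma hasSum_transition {t : ℝ} (ht : 0 ≤ t) (x : L1) (j : ℕ) :
    HasSum (fun i => x i * transition Q t i j) (hQ.semi t x j) := by
  simp only [hQ.transition_eq ht]
  simpa using (hasSum_map (hQ.semi t) x).mapL (coord j)

lemma gen_eq_of_catastrophe
    (hβ : ∀ i j, Q i j = Q' i j + β * ((if j = 0 then 1 else 0) - if i = j then 1 else 0))
    (x : L1) : hQ.gen x = hQ'.gen x - β • x + (β * mass x) • unitVec 0 := by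
  have h : hQ.gen = hQ'.gen - β • (1 : L1 →L[ℝ] L1) + β • mass.smulRight (unitVec 0) := by
    refine ext_unitVec fun i => ?_
    have h1 : hQ.row i = hQ'.row i - β • unitVec i + β • unitVec 0 := by
      ext j
      change Q i j = Q' i j - β * unitVec i j + β * unitVec 0 j
      rw [hβ, unitVec_apply, unitVec_apply]
      simp only [eq_comm (a := 0) (b := j)]
      ring
    simp [gen_unitVec, h1, mass_unitVec]
  rw [h]
  simp [smul_smul]

/-- `Q' - β` preserves mass zero, and on such vectors it agrees with `Q`; by induction all powers
agree on `x`. -/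
lemma semi_apply_of_mass_eq_zero
    (hβ : ∀ i j, Q i j = Q' i j + β * ((if j = 0 then 1 else 0) - if i = j then 1 else 0))
    {x : L1} (hx : mass x = 0) (t : ℝ) :
    hQ.semi t x = Real.exp (-(β * t)) • hQ'.semi t x := by
  set D : L1 →L[ℝ] L1 := hQ'.gen + (-β) • 1 with hD
  have hDy : ∀ y, D y = hQ'.gen y - β • y := fun y => by simp [hD, sub_eq_add_neg]
  have hpow : ∀ n : ℕ, mass ((D ^ n) x) = 0 ∧ (hQ.gen ^ n) x = (D ^ n) x := by
    intro n
    induction n with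
    | zero => simpa using hx
    | succ n ih =>
      simp only [pow_succ', mul_apply_eq_comp]
      rw [ih.2, gen_eq_of_catastrophe hQ hQ' hβ, ih.1]
      rw [hDy, map_sub, mass_gen, map_smul, ih.1]
      simp
  have h1 : hQ.semi t x = NormedSpace.exp (t • D) x :=
    exp_apply_eq fun n => by simp [smul_pow, (hpow n).2]
  have h2 : t • D = t • hQ'.gen + (-(β * t)) • (1 : L1 →L[ℝ] L1) := by
    rw [hD]; module
  rw [h1, h2, exp_add_smul_one]
  rfl

/-- Catastrophes at rate `β` make any normalised null vector of the generator the equilibrium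
distribution, with exponential convergence at rate `β`. -/
theorem isEquilibriumDistribution (hQ' : IsBddQ Q' M') (hβ_pos : 0 < β)
    (hβ : ∀ i j, Q i j = Q' i j + β * ((if j = 0 then 1 else 0) - if i = j then 1 else 0))
    {x : L1} (hx_nonneg : ∀ j, 0 ≤ x j) (hx_mass : mass x = 1) (hx : hQ.gen x = 0) :
    IsEquilibriumDistribution (transition Q) (fun j => x j) := by
  have hexp : Tendsto (fun t : ℝ => Real.exp (-(β * t)) * 2) atTop (𝓝 0) := by
    have := (Real.tendsto_exp_neg_atTop_nhds_zero.comp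
      (tendsto_id.const_mul_atTop hβ_pos)).mul_const 2
    simpa using this
  have hdist : ∀ y : L1, (∀ j, 0 ≤ y j) → mass y = 1 → ∀ t : ℝ, 0 ≤ t →
      ‖hQ.semi t y - x‖ ≤ Real.exp (-(β * t)) * 2 := by
    intro y hy hy1 t ht
    have h0 : mass (y - x) = 0 := by rw [map_sub, hy1, hx_mass, sub_self]
    -- `x` is fixed by the semigroup and `y - x` has mass zero, so the distance to equilibrium
    -- decays like `e^{-βt}`.
    have h1 : hQ.semi t y - x = Real.exp (-(β * t)) • hQ'.semi t (y - x) := by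
      rw [← semi_apply_of_mass_eq_zero hQ hQ' hβ h0, map_sub, hQ.semi_apply_of_gen_eq_zero hx]
    rw [h1, norm_smul, Real.norm_of_nonneg (Real.exp_pos _).le]
    gcongr
    calc _ ≤ ‖y - x‖ := hQ'.norm_semi_apply_le ht _
      _ ≤ ‖y‖ + ‖x‖ := norm_sub_le _ _
      _ = 2 := by rw [norm_eq_mass hy, norm_eq_mass hx_nonneg, hy1, hx_mass]; norm_num
  refine ⟨⟨hx_nonneg, hx_mass ▸ hasSum_mass x, fun t ht j => ?_⟩, fun ν hν => ?_, fun i j => ?_⟩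
  · simpa only [hQ.semi_apply_of_gen_eq_zero hx] using hQ.hasSum_transition ht x j
  · set y : L1 := ofSummable ν hν.hasSum_one.summable
    have hy1 : mass y = 1 := (hasSum_mass y).unique hν.hasSum_one
    have hinv : ∀ t : ℝ, 0 ≤ t → hQ.semi t y = y := fun t ht => by
      ext j
      exact (hQ.hasSum_transition ht y j).unique (hν.invariant t ht j)
    have h0 : ‖y - x‖ ≤ 0 := ge_of_tendsto hexp <| by
      filter_upwards [eventually_ge_atTop 0] with t ht
      have := hdist y hν.nonneg hy1 t ht
      rwa [hinv t ht] at this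
    have hyx : y = x := sub_eq_zero.1 (norm_le_zero_iff.1 h0)
    rw [← hyx]
    rfl
  · rw [tendsto_iff_norm_sub_tendsto_zero]
    refine squeeze_zero' (Eventually.of_forall fun _ => norm_nonneg _) ?_ hexp
    filter_upwards [eventually_ge_atTop 0] with t ht
    rw [hQ.transition_eq ht]
    exact (abs_apply_le_norm (hQ.semi t (unitVec i) - x) j).trans
      (hdist _ (nonneg_unitVec i) (mass_unitVec i) t ht)

/-! ### The resolvent -/

/-- The resolvent `∫₀^∞ e^{-λt} exp (tQ) dt` on `ℓ¹`. -/
noncomputable def res (lam : ℝ) : L1 →L[ℝ] L1 :=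
  ∫ t in Ioi (0 : ℝ), Real.exp (-(lam * t)) • hQ.semi t

lemma norm_semi_le {t : ℝ} (ht : 0 ≤ t) : ‖hQ.semi t‖ ≤ 1 :=
  ContinuousLinearMap.opNorm_le_bound _ zero_le_one fun x => by
    simpa using hQ.norm_semi_apply_le ht x

lemma integrableOn_exp_smul_semi {lam : ℝ} (hl : 0 < lam) :
    IntegrableOn (fun t : ℝ => Real.exp (-(lam * t)) • hQ.semi t) (Ioi 0) := by
  have hc : Continuous fun t : ℝ => Real.exp (-(lam * t)) • hQ.semi t := by
    have := hQ.continuous_semi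
    fun_prop
  have hi : IntegrableOn (fun t : ℝ => Real.exp (-lam * t)) (Ioi 0) :=
    exp_neg_integrableOn_Ioi 0 hl
  refine Integrable.mono' hi hc.aestronglyMeasurable ?_
  refine (ae_restrict_iff' measurableSet_Ioi).2 (Eventually.of_forall fun t ht => ?_)
  rw [norm_smul, Real.norm_of_nonneg (Real.exp_pos _).le, neg_mul]
  exact mul_le_of_le_one_right (Real.exp_pos _).le (hQ.norm_semi_le (le_of_lt ht))

lemma res_apply {lam : ℝ} (hl : 0 < lam) (x : L1) (j : ℕ) :
    hQ.res lam x j = ∫ t in Ioi (0 : ℝ), Real.exp (-(lam * t)) * hQ.semi t x j :=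
  (((coord j).comp (ContinuousLinearMap.apply ℝ L1 x)).integral_comp_comm
    (hQ.integrableOn_exp_smul_semi hl)).symm

lemma resolvent_eq {lam : ℝ} (hl : 0 < lam) (i j : ℕ) :
    resolvent Q lam i j = hQ.res lam (unitVec i) j := by
  rw [hQ.res_apply hl, resolvent]
  refine setIntegral_congr_fun measurableSet_Ioi fun t ht => ?_
  simp only [hQ.transition_eq (le_of_lt ht)]

lemma res_nonneg {lam : ℝ} (hl : 0 < lam) {x : L1} (hx : ∀ j, 0 ≤ x j) (j : ℕ) :
    0 ≤ hQ.res lam x j := by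
  rw [hQ.res_apply hl]
  exact setIntegral_nonneg measurableSet_Ioi fun t ht =>
    mul_nonneg (Real.exp_pos _).le ((hQ.isPos_semi (le_of_lt ht)).apply_nonneg hx j)

/-- Integrate the derivative of `e^{-λt} exp (tQ)`, which is `Q - λ` times the function itself, over
`(0, ∞)`; the boundary values are `1` at `0` and `0` at infinity. -/
lemma gen_res_apply {lam : ℝ} (hl : 0 < lam) (x : L1) :
    hQ.gen (hQ.res lam x) = lam • hQ.res lam x - x := by
  set T : (L1 →L[ℝ] L1) →L[ℝ] (L1 →L[ℝ] L1) :=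
    ContinuousLinearMap.mul ℝ (L1 →L[ℝ] L1) hQ.gen + (-lam) • ContinuousLinearMap.id ℝ _ with hT
  have hint := hQ.integrableOn_exp_smul_semi hl
  have hd : ∀ t ∈ Ici (0 : ℝ), HasDerivAt (fun t : ℝ => Real.exp (-(lam * t)) • hQ.semi t)
      (T (Real.exp (-(lam * t)) • hQ.semi t)) t := by
    intro t _
    have h1 : HasDerivAt (fun t : ℝ => Real.exp (-(lam * t)))
        (Real.exp (-(lam * t)) * -lam) t := by
      simpa using (((hasDerivAt_id t).const_mul lam).neg).exp
    refine (h1.smul (hQ.hasDerivAt_semi' t)).congr_deriv ?_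
    simp only [hT, add_apply, smul_apply, map_smul,
      ContinuousLinearMap.mul_apply', ContinuousLinearMap.id_apply, smul_add, smul_smul]
  have hlim : Tendsto (fun t : ℝ => Real.exp (-(lam * t)) • hQ.semi t) atTop (𝓝 0) := by
    have hexp : Tendsto (fun t : ℝ => Real.exp (-(lam * t))) atTop (𝓝 0) :=
      Real.tendsto_exp_neg_atTop_nhds_zero.comp (tendsto_id.const_mul_atTop hl)
    refine squeeze_zero_norm' ?_ hexp
    filter_upwards [eventually_ge_atTop 0] with t ht
    rw [norm_smul, Real.norm_of_nonneg (Real.exp_pos _).le]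
    exact mul_le_of_le_one_right (Real.exp_pos _).le (hQ.norm_semi_le ht)
  have h := integral_Ioi_of_hasDerivAt_of_tendsto' hd (T.integrable_comp hint) hlim
  rw [T.integral_comp_comm hint, mul_zero, neg_zero, Real.exp_zero, one_smul, semi_zero,
    zero_sub] at h
  have h2 := congrArg (fun S : L1 →L[ℝ] L1 => S x) h
  change hQ.gen (hQ.res lam x) + (-lam) • hQ.res lam x = -x at h2
  rw [eq_sub_iff_add_eq, ← sub_eq_zero]
  rw [← sub_eq_zero] at h2
  rw [← h2]
  module

end IsBddQ

/-! ### Rows of the `q`-matrices of the queue -/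

section Rows

variable {c : ℕ} {b h : ℕ → ℝ} {β : ℝ}

lemma hasSum_congr {f g : ℕ → ℝ} {a : ℝ} (hfg : ∀ j, f j = g j) : HasSum f a ↔ HasSum g a := by
  rw [funext hfg]

lemma summable_mul_pow {a : ℕ → ℝ} (ha : Summable a) {s : ℝ} (hs : |s| ≤ 1) :
    Summable (fun j => a j * s ^ j) := by
  refine Summable.of_norm_bounded ha.abs fun j => ?_
  rw [norm_mul, norm_pow, Real.norm_eq_abs, Real.norm_eq_abs]
  exact mul_le_of_le_one_right (abs_nonneg _) (pow_le_one₀ (abs_nonneg _) hs)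

lemma hasSum_qStar_succ (hb : Summable b) {s : ℝ} (hs : |s| ≤ 1) (n : ℕ) :
    HasSum (fun j => qStar c b (n + 1) j * s ^ j) (s ^ n * genBi b (min (n + 1) c) s) := by
  set m : ℝ := ((min (n + 1) c : ℕ) : ℝ) with hm
  have h1 : HasSum (fun k => b k * s ^ k) (genB b s) := (summable_mul_pow hb hs).hasSum
  have h2 : HasSum (fun k : ℕ => if k = 0 then (m - 1) * b 0 else 0) ((m - 1) * b 0) :=
    hasSum_ite_eq 0 _
  have h3 : HasSum (fun k : ℕ => if k = 1 then (m - 1) * b 0 * s else 0) ((m - 1) * b 0 * s) :=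
    hasSum_ite_eq 1 _
  have h4 := ((h1.add h2).sub h3).mul_left (s ^ n)
  -- The row is supported on the columns `n + k`, where its entry is `b k` up to the corrections `±
  -- (m - 1) b 0` at `k = 0` and `k = 1`.
  have h5 : Function.Injective fun k : ℕ => n + k := add_right_injective n
  rw [← h5.hasSum_iff]
  · have h6 : s ^ n * genBi b (min (n + 1) c) s =
        s ^ n * (genB b s + (m - 1) * b 0 - (m - 1) * b 0 * s) := by
      rw [genBi, ← hm]; ring
    rw [h6]
    refine (hasSum_congr fun k => ?_).2 h4
    · simp only [Function.comp, qStar, ← hm]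
      rcases k with _ | _ | k
      · simp; ring
      · simp; ring
      · have e4 : n + (k + 1 + 1) - (n + 1) + 1 = k + 2 := by omega
        simp [e4]
        ring
  · intro j hj
    have hj' : j < n := by
      by_contra hc
      exact hj ⟨j - n, by simp only; omega⟩
    have e1 : j ≠ n := by omega
    have e2 : j ≠ n + 1 := by omega
    have e3 : ¬ n + 1 < j := by omega
    simp [qStar, e1, e2, e3]

lemma hasSum_genH (hh : Summable h) {s : ℝ} (hs : |s| ≤ 1) :
    HasSum (fun j => h (j + 1) * s ^ (j + 1)) (genH h s) :=
  ((summable_nat_add_iff 1).2 (summable_mul_pow hh hs)).hasSum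

lemma genH_one : genH h 1 = hTotal h := by simp [genH, hTotal]

lemma hasSum_qRes_zero (hh : Summable h) {s : ℝ} (hs : |s| ≤ 1) :
    HasSum (fun j => qRes h 0 j * s ^ j) (genH h s - hTotal h) := by
  rw [← hasSum_nat_add_iff' 1]
  simpa [qRes] using hasSum_genH hh hs

lemma qRes_succ (i j : ℕ) : qRes h (i + 1) j = 0 := by simp [qRes]

lemma qStar_zero (j : ℕ) : qStar c b 0 j = 0 := by simp [qStar]

lemma qCat_eq (i j : ℕ) :
    qCat β i j = β * ((if j = 0 then 1 else 0) - if i = j then 1 else 0) := by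
  rcases i with _ | i
  · rcases j with _ | j <;> simp [qCat]
  · rcases j with _ | j
    · simp [qCat]
    · by_cases hij : j = i
      · simp [qCat, hij]
      · simp [qCat, hij, Ne.symm hij]

lemma hasSum_qCat (s : ℝ) (i : ℕ) : HasSum (fun j => qCat β i j * s ^ j) (β * (1 - s ^ i)) := by
  have h1 : HasSum (fun j : ℕ => if j = 0 then (1 : ℝ) else 0) 1 := hasSum_ite_eq 0 _
  have h2 : HasSum (fun j : ℕ => if j = i then s ^ i else 0) (s ^ i) := hasSum_ite_eq i _
  refine (hasSum_congr fun j => ?_).2 ((h1.sub h2).mul_left β)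
  rw [qCat_eq]
  by_cases hj : j = 0
  · subst hj
    by_cases hi : i = 0
    · subst hi; simp
    · simp [hi, Ne.symm hi]
  · by_cases hi : i = j
    · subst hi; simp [hj]
    · simp [hj, hi, Ne.symm hi]

lemma genB_one (hb : Summable b) (hb_one : -b 1 = b 0 + ∑' j : ℕ, b (j + 2)) : genB b 1 = 0 := by
  have h1 := hb.sum_add_tsum_nat_add 2
  simp only [Finset.sum_range_succ, Finset.sum_range_zero] at h1
  simp only [genB, one_pow, mul_one]
  linarith

lemma genBi_eq (i : ℕ) (s : ℝ) :
    genBi b i s = genBi b c s - ((c : ℝ) - i) * b 0 * (1 - s) := by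
  simp only [genBi]; ring

lemma genBi_one (hb : Summable b) (hb_one : -b 1 = b 0 + ∑' j : ℕ, b (j + 2)) (i : ℕ) :
    genBi b i 1 = 0 := by
  simp [genBi, genB_one hb hb_one]

lemma qStar_nonneg (hb_nonneg : ∀ j, j ≠ 1 → 0 ≤ b j) {i j : ℕ} (hij : i ≠ j) :
    0 ≤ qStar c b i j := by
  have h0 := hb_nonneg 0 (by norm_num)
  simp only [qStar]
  split_ifs with h1 h2 h3 h4
  · exact le_rfl
  · positivity
  · exact absurd h3.symm hij
  · exact hb_nonneg _ (by omega)
  · exact le_rfl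

lemma neg_qStar_diag_le (h1 : b 1 ≤ 0) (h0 : 0 ≤ b 0) (i : ℕ) :
    -qStar c b i i ≤ -b 1 + c * b 0 := by
  simp only [qStar]
  split_ifs with h2 h3
  · have : 0 ≤ (c : ℝ) * b 0 := by positivity
    linarith
  · omega
  · have : ((min i c : ℕ) : ℝ) ≤ c := by exact_mod_cast min_le_right i c
    nlinarith

lemma qRes_nonneg (hh_nonneg : ∀ j, 1 ≤ j → 0 ≤ h j) {i j : ℕ} (hij : i ≠ j) :
    0 ≤ qRes h i j := by
  simp only [qRes]
  split_ifs with h1 h2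
  · exact absurd (h1.trans h2.symm) hij
  · exact hh_nonneg j (by omega)
  · exact le_rfl

lemma hTotal_nonneg (hh_nonneg : ∀ j, 1 ≤ j → 0 ≤ h j) : 0 ≤ hTotal h :=
  tsum_nonneg fun j => hh_nonneg _ (by omega)

lemma neg_qRes_diag_le (hh_nonneg : ∀ j, 1 ≤ j → 0 ≤ h j) (i : ℕ) :
    -qRes h i i ≤ hTotal h := by
  have := hTotal_nonneg hh_nonneg
  simp only [qRes]
  split_ifs <;> simp [this]

lemma b_one_nonpos (hb_nonneg : ∀ j, j ≠ 1 → 0 ≤ b j)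
    (hb_one : -b 1 = b 0 + ∑' j : ℕ, b (j + 2)) : b 1 ≤ 0 := by
  have h0 := hb_nonneg 0 (by norm_num)
  have : 0 ≤ ∑' j : ℕ, b (j + 2) := tsum_nonneg fun j => hb_nonneg _ (by omega)
  linarith

lemma isBddQ_qStar (hb_nonneg : ∀ j, j ≠ 1 → 0 ≤ b j) (hb : Summable b)
    (hb_one : -b 1 = b 0 + ∑' j : ℕ, b (j + 2)) : IsBddQ (qStar c b) (-b 1 + c * b 0) where
  nonneg _ _ := qStar_nonneg hb_nonneg
  hasSum i := by
    rcases i with _ | i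
    · exact (hasSum_congr qStar_zero).2 hasSum_zero
    · simpa [genBi_one hb hb_one] using hasSum_qStar_succ (c := c) hb (s := 1) (by simp) i
  bound := neg_qStar_diag_le (b_one_nonpos hb_nonneg hb_one) (hb_nonneg 0 (by norm_num))
  bound_nonneg := by
    have h0 := hb_nonneg 0 (by norm_num)
    have h1 := b_one_nonpos hb_nonneg hb_one
    have : 0 ≤ (c : ℝ) * b 0 := by positivity
    linarith

lemma isBddQ_qRes (hh_nonneg : ∀ j, 1 ≤ j → 0 ≤ h j) (hh : Summable h) :
    IsBddQ (qRes h) (hTotal h) where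
  nonneg _ _ := qRes_nonneg hh_nonneg
  hasSum i := by
    rcases i with _ | i
    · simpa [genH_one] using hasSum_qRes_zero hh (s := 1) (by simp)
    · exact (hasSum_congr (qRes_succ i)).2 hasSum_zero
  bound := neg_qRes_diag_le hh_nonneg
  bound_nonneg := hTotal_nonneg hh_nonneg

lemma isBddQ_qCat (hβ : 0 ≤ β) : IsBddQ (qCat β) β where
  nonneg i j hij := by
    rw [qCat_eq, if_neg hij, sub_zero]
    split_ifs <;> simp [hβ]
  hasSum i := by simpa using hasSum_qCat (β := β) 1 i
  bound i := by
    rw [qCat_eq]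
    split_ifs <;> simp_all
  bound_nonneg := hβ

lemma IsBddQ.add {Q Q' : ℕ → ℕ → ℝ} {M M' : ℝ} (hQ : IsBddQ Q M) (hQ' : IsBddQ Q' M') :
    IsBddQ (fun i j => Q i j + Q' i j) (M + M') where
  nonneg i j hij := add_nonneg (hQ.nonneg i j hij) (hQ'.nonneg i j hij)
  hasSum i := by simpa using (hQ.hasSum i).add (hQ'.hasSum i)
  bound i := by linarith [hQ.bound i, hQ'.bound i]
  bound_nonneg := add_nonneg hQ.bound_nonneg hQ'.bound_nonneg

end Rows

/-! ### The root `u(β)` -/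

section Root

variable {c : ℕ} {b : ℕ → ℝ} {β : ℝ}

lemma continuousOn_genB (hb : Summable b) : ContinuousOn (genB b) (Icc (-1) 1) := by
  refine continuousOn_tsum (u := fun j => |b j|) (fun j => by fun_prop) hb.abs fun j s hs => ?_
  rw [norm_mul, norm_pow, Real.norm_eq_abs, Real.norm_eq_abs]
  exact mul_le_of_le_one_right (abs_nonneg _) (pow_le_one₀ (abs_nonneg _) (abs_le.2 hs))

lemma continuousOn_genU (hb : Summable b) : ContinuousOn (genU c b β) (Icc (-1) 1) := by
  have h := continuousOn_genB hb
  unfold genU genBi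
  fun_prop

/-- Termwise convexity of the powers. The possibly negative coefficient `b 1` does no harm, because
its term is affine. -/
lemma genB_le_of_convex (hb_nonneg : ∀ j, j ≠ 1 → 0 ≤ b j) (hb : Summable b) {s θ : ℝ}
    (hs : s ∈ Icc (0 : ℝ) 1) (hθ : θ ∈ Icc (0 : ℝ) 1) :
    genB b ((1 - θ) * s + θ) ≤ (1 - θ) * genB b s + θ * genB b 1 := by
  have hs1 : |s| ≤ 1 := abs_le.2 ⟨by linarith [hs.1], hs.2⟩
  have hr : |(1 - θ) * s + θ| ≤ 1 := by
    have h1 : 0 ≤ (1 - θ) * s := mul_nonneg (by linarith [hθ.2]) hs.1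
    have h2 : (1 - θ) * s ≤ 1 - θ := mul_le_of_le_one_right (by linarith [hθ.2]) hs.2
    exact abs_le.2 ⟨by linarith [hθ.1], by linarith⟩
  refine hasSum_le (fun j => ?_) (summable_mul_pow hb hr).hasSum
    (((summable_mul_pow hb hs1).hasSum.mul_left (1 - θ)).add
      ((summable_mul_pow hb (s := 1) (by simp)).hasSum.mul_left θ))
  by_cases hj : j = 1
  · subst hj
    apply le_of_eq
    ring
  · have h := (convexOn_pow j).2 (mem_Ici.2 hs.1) (mem_Ici.2 zero_le_one)
      (sub_nonneg.2 hθ.2) hθ.1 (by ring)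
    simp only [smul_eq_mul, mul_one] at h
    have := mul_le_mul_of_nonneg_left h (hb_nonneg j hj)
    linarith

/-- For `s ∈ [-1, 0]` one has `s ^ (j + 2) ≥ s`; replacing these powers by `s` and using that the `b
j` sum to zero gives `B(s) ≥ b 0 (1 - s)`. -/
lemma genB_pos_of_nonpos (hb_nonneg : ∀ j, j ≠ 1 → 0 ≤ b j) (hb : Summable b)
    (hb_one : -b 1 = b 0 + ∑' j : ℕ, b (j + 2)) (hb_zero : 0 < b 0) {s : ℝ}
    (hs : s ∈ Icc (-1 : ℝ) 0) : 0 < genB b s := by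
  have hs1 : |s| ≤ 1 := abs_le.2 ⟨hs.1, by linarith [hs.2]⟩
  have h1 := (summable_mul_pow hb hs1).sum_add_tsum_nat_add 2
  simp only [Finset.sum_range_succ, Finset.sum_range_zero] at h1
  have h2 : (∑' j : ℕ, b (j + 2)) * s ≤ ∑' j : ℕ, b (j + 2) * s ^ (j + 2) := by
    refine hasSum_le (fun j => ?_) (((summable_nat_add_iff 2).2 hb).hasSum.mul_right s)
      ((summable_nat_add_iff 2).2 (summable_mul_pow hb hs1)).hasSum
    refine mul_le_mul_of_nonneg_left ?_ (hb_nonneg _ (by omega))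
    have h3 : |s| ^ (j + 2) ≤ |s| := pow_le_of_le_one (abs_nonneg s) hs1 (by omega)
    rw [← abs_pow, abs_of_nonpos hs.2] at h3
    linarith [neg_abs_le (s ^ (j + 2))]
  have h4 : genB b s = 0 + b 0 * s ^ 0 + b 1 * s ^ 1 + ∑' j : ℕ, b (j + 2) * s ^ (j + 2) := h1.symm
  rw [h4]
  nlinarith [hs.2]

lemma genU_one (hb : Summable b) (hb_one : -b 1 = b 0 + ∑' j : ℕ, b (j + 2)) :
    genU c b β 1 = -β := by
  simp [genU, genBi_one hb hb_one]

lemma genU_pos_of_nonpos (hc : 1 ≤ c) (hb_nonneg : ∀ j, j ≠ 1 → 0 ≤ b j) (hb : Summable b)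
    (hb_one : -b 1 = b 0 + ∑' j : ℕ, b (j + 2)) (hb_zero : 0 < b 0) (hβ : 0 < β) {s : ℝ}
    (hs : s ∈ Icc (-1 : ℝ) 0) : 0 < genU c b β s := by
  have h1 := genB_pos_of_nonpos hb_nonneg hb hb_one hb_zero hs
  have h2 : (0 : ℝ) ≤ (c : ℝ) - 1 := by
    have : (1 : ℝ) ≤ c := by exact_mod_cast hc
    linarith
  have h3 : 0 ≤ ((c : ℝ) - 1) * b 0 * (1 - s) :=
    mul_nonneg (mul_nonneg h2 hb_zero.le) (by linarith [hs.2])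
  have h4 : 0 ≤ β * -s := mul_nonneg hβ.le (by linarith [hs.2])
  unfold genU genBi
  linarith

/-- By convexity `U_β` lies below its chord from `(u, 0)` to `(1, -β)`. Hence nothing to the right
of a root in `[0, 1)` is another root. -/
lemma genU_neg_of_lt (hb_nonneg : ∀ j, j ≠ 1 → 0 ≤ b j) (hb : Summable b)
    (hb_one : -b 1 = b 0 + ∑' j : ℕ, b (j + 2)) (hβ : 0 < β) {u s : ℝ}
    (hu : 0 ≤ u) (hus : u < s) (hs : s ≤ 1) (hU : genU c b β u = 0) : genU c b β s < 0 := by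
  have h1 : 0 < 1 - u := by linarith
  set θ := (s - u) / (1 - u) with hθ
  have hθ0 : 0 < θ := div_pos (by linarith) h1
  have hθ1 : θ ≤ 1 := (div_le_one h1).2 (by linarith)
  have hs' : s = (1 - θ) * u + θ := by
    rw [hθ]; field_simp; ring
  have h2 := genB_le_of_convex hb_nonneg hb (s := u) ⟨hu, by linarith⟩ ⟨hθ0.le, hθ1⟩
  rw [← hs', genB_one hb hb_one] at h2
  have h3 : genB b u = -(((c : ℝ) - 1) * b 0 * (1 - u)) + β * u := by
    unfold genU genBi at hU
    linarith
  rw [h3] at h2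
  have h4 : genU c b β s ≤ -(β * θ) := by
    unfold genU genBi
    rw [hs'] at h2 ⊢
    linarith
  linarith [mul_pos hβ hθ0]

lemma rootU_spec (hc : 1 ≤ c) (hb_nonneg : ∀ j, j ≠ 1 → 0 ≤ b j) (hb : Summable b)
    (hb_one : -b 1 = b 0 + ∑' j : ℕ, b (j + 2)) (hb_zero : 0 < b 0) (hβ : 0 < β) :
    0 < rootU c b β ∧ rootU c b β < 1 ∧ genU c b β (rootU c b β) = 0 ∧
      ∀ s ∈ Icc (-1 : ℝ) 1, s ≠ rootU c b β → genU c b β s ≠ 0 := by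
  have hneg : ∀ {s : ℝ}, s ∈ Icc (-1 : ℝ) 0 → 0 < genU c b β s :=
    genU_pos_of_nonpos hc hb_nonneg hb hb_one hb_zero hβ
  have h1 : genU c b β 1 = -β := genU_one hb hb_one
  obtain ⟨u, hu, hU⟩ : (0 : ℝ) ∈ genU c b β '' Icc 0 1 :=
    intermediate_value_Icc' zero_le_one
      ((continuousOn_genU hb).mono (Icc_subset_Icc_left (by norm_num)))
      ⟨by rw [h1]; linarith, (hneg ⟨by norm_num, le_rfl⟩).le⟩
  have hu0 : 0 < u := by
    refine lt_of_le_of_ne hu.1 fun h => ?_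
    subst h
    linarith [hneg (s := 0) ⟨by norm_num, le_rfl⟩]
  have hu1 : u < 1 := by
    refine lt_of_le_of_ne hu.2 fun h => ?_
    subst h
    linarith
  have huniq : ∀ s ∈ Icc (-1 : ℝ) 1, genU c b β s = 0 → s = u := by
    intro s hs hUs
    have hs0 : 0 < s := by
      by_contra h
      linarith [hneg ⟨hs.1, not_lt.1 h⟩]
    rcases lt_trichotomy s u with h | h | h
    · linarith [genU_neg_of_lt hb_nonneg hb hb_one hβ hs0.le h hu1.le hUs]
    · exact h
    · linarith [genU_neg_of_lt hb_nonneg hb hb_one hβ hu0.le h hs.2 hU]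
  have hroot : rootU c b β = u := by
    have : {s : ℝ | s ∈ Icc (0 : ℝ) 1 ∧ genU c b β s = 0} = {u} := by
      ext s
      constructor
      · exact fun hs => huniq s ⟨by linarith [hs.1.1], hs.1.2⟩ hs.2
      · rintro rfl
        exact ⟨hu, hU⟩
    rw [rootU, this, csInf_singleton]
  rw [hroot]
  exact ⟨hu0, hu1, hU, fun s hs hne h => hne (huniq s hs h)⟩

end Root

/-! ### The stationary vector -/

section Stationary

variable {c : ℕ} {b h : ℕ → ℝ} {β : ℝ}

lemma IsBddQ.gen_add {Q Q' : ℕ → ℕ → ℝ} {M M' : ℝ} (hQ : IsBddQ Q M) (hQ' : IsBddQ Q' M')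
    (x : L1) : (hQ.add hQ').gen x = hQ.gen x + hQ'.gen x := by
  have h : (hQ.add hQ').gen = hQ.gen + hQ'.gen := by
    refine ext_unitVec fun i => ?_
    simp only [add_apply, IsBddQ.gen_unitVec]
    rfl
  rw [h, add_apply]

/-- The resurrection rates as an element of `ℓ¹`. -/
noncomputable def resVec (h : ℕ → ℝ) (hh : Summable h) : L1 :=
  ofSummable h hh - h 0 • unitVec 0

/-- The value `h 0` is unconstrained and plays no role in the model, so it is subtracted out. -/
lemma resVec_zero (hh : Summable h) : resVec h hh 0 = 0 := by
  change h 0 - h 0 * unitVec 0 0 = 0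
  simp [unitVec_apply]

lemma resVec_succ (hh : Summable h) (j : ℕ) : resVec h hh (j + 1) = h (j + 1) := by
  change h (j + 1) - h 0 * unitVec 0 (j + 1) = h (j + 1)
  simp [unitVec_apply]

lemma resVec_nonneg (hh : Summable h) (hh_nonneg : ∀ j, 1 ≤ j → 0 ≤ h j) (j : ℕ) :
    0 ≤ resVec h hh j := by
  rcases j with _ | j
  · rw [resVec_zero]
  · rw [resVec_succ]; exact hh_nonneg _ (by omega)

lemma gen_qRes (hh_nonneg : ∀ j, 1 ≤ j → 0 ≤ h j) (hh : Summable h) (x : L1) :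
    (isBddQ_qRes hh_nonneg hh).gen x = x 0 • (resVec h hh - hTotal h • unitVec 0) := by
  ext j
  refine ((isBddQ_qRes hh_nonneg hh).hasSum_gen x j).unique ?_
  have h1 : (x 0 • (resVec h hh - hTotal h • unitVec 0)) j = x 0 * qRes h 0 j := by
    change x 0 * (resVec h hh j - hTotal h * unitVec 0 j) = _
    rcases j with _ | j
    · simp [resVec_zero, unitVec_apply, qRes]
    · simp [resVec_succ, unitVec_apply, qRes]
  rw [h1]
  refine hasSum_single 0 fun i hi => ?_
  obtain ⟨i, rfl⟩ := Nat.exists_eq_succ_of_ne_zero hi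
  rw [Nat.succ_eq_add_one, qRes_succ, mul_zero]

lemma bigL_eq (hQ : IsBddQ (qStar c b) (-b 1 + c * b 0)) (hh : Summable h) (hβ : 0 < β) (j : ℕ) :
    bigL c b h β j = hQ.res β (resVec h hh) j := by
  have h1 := (hasSum_map (hQ.res β) (resVec h hh)).mapL (coord j)
  simp only [map_smul, coord_apply, smul_eq_mul] at h1
  rw [← hasSum_nat_add_iff' 1] at h1
  simp only [Finset.sum_range_one, resVec_zero, resVec_succ, zero_mul, sub_zero] at h1
  simp only [bigL, hQ.resolvent_eq hβ]
  exact h1.tsum_eq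

lemma isBddQ_qMatrix (hb_nonneg : ∀ j, j ≠ 1 → 0 ≤ b j) (hb : Summable b)
    (hb_one : -b 1 = b 0 + ∑' j : ℕ, b (j + 2)) (hh_nonneg : ∀ j, 1 ≤ j → 0 ≤ h j)
    (hh : Summable h) (hβ : 0 ≤ β) :
    IsBddQ (qMatrix c b h β) (-b 1 + c * b 0 + hTotal h + β) :=
  ((isBddQ_qStar hb_nonneg hb hb_one).add (isBddQ_qRes hh_nonneg hh)).add (isBddQ_qCat hβ)

lemma qMatrix_eq (i j : ℕ) : qMatrix c b h β i j = (qStar c b i j + qRes h i j) +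
    β * ((if j = 0 then 1 else 0) - if i = j then 1 else 0) := by
  rw [qMatrix, qCat_eq]

/-- There is a probability vector in the kernel of the generator, proportional to
`(1, L_1(β), L_2(β), …)`. -/
lemma exists_gen_eq_zero (hb_nonneg : ∀ j, j ≠ 1 → 0 ≤ b j) (hb : Summable b)
    (hb_one : -b 1 = b 0 + ∑' j : ℕ, b (j + 2)) (hh_nonneg : ∀ j, 1 ≤ j → 0 ≤ h j)
    (hh : Summable h) (hβ : 0 < β) :
    ∃ x : L1, (∀ j, 0 ≤ x j) ∧ mass x = 1 ∧
      (isBddQ_qMatrix (c := c) hb_nonneg hb hb_one hh_nonneg hh hβ.le).gen x = 0 ∧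
      ∀ j, 1 ≤ j → x j = x 0 * bigL c b h β j := by
  set hQ := isBddQ_qMatrix (c := c) hb_nonneg hb hb_one hh_nonneg hh hβ.le
  have hQs := isBddQ_qStar (c := c) hb_nonneg hb hb_one
  have hQr := isBddQ_qRes hh_nonneg hh
  set y : L1 := hQs.res β (resVec h hh) with hy
  have hy_nonneg : ∀ j, 0 ≤ y j := hQs.res_nonneg hβ (resVec_nonneg hh hh_nonneg)
  -- State `0` is absorbing for `Q*`, so changing this coordinate leaves the image under `Q*`
  -- untouched; the value `1` makes resurrection feed in exactly the vector that the resolvent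
  -- identity removes.
  set w : L1 := y + (1 - y 0) • unitVec 0 with hw
  have hw0 : w 0 = 1 := by
    change y 0 + (1 - y 0) * unitVec 0 0 = 1
    simp [unitVec_apply]
  have hwj : ∀ j, 1 ≤ j → w j = y j := fun j hj => by
    change y j + (1 - y 0) * unitVec 0 j = y j
    have : 0 ≠ j := by omega
    simp [unitVec_apply, this]
  have hw_nonneg : ∀ j, 0 ≤ w j := fun j => by
    rcases j with _ | j
    · rw [hw0]; exact zero_le_one
    · rw [hwj _ (by omega)]; exact hy_nonneg _
  have hw_mass : 0 < mass w := by
    refine zero_lt_one.trans_le (hw0 ▸ le_hasSum (hasSum_mass w) 0 fun j _ => hw_nonneg j)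
  have hrow : hQs.gen (unitVec 0) = 0 := by
    rw [hQs.gen_unitVec]
    ext j
    exact qStar_zero (c := c) (b := b) j
  have hgen : hQ.gen w = 0 := by
    have h1 : hQ.gen w = (β * mass w - hTotal h - β * (1 - y 0)) • unitVec 0 := by
      rw [IsBddQ.gen_eq_of_catastrophe hQ (hQs.add hQr) qMatrix_eq, IsBddQ.gen_add hQs hQr, gen_qRes hh_nonneg hh, hw0,
        hw, map_add, map_smul, hrow, hy, hQs.gen_res_apply hβ]
      module
    -- The image is a multiple of `e₀`, and conservativity forces the multiple to be zero without
    -- computing it.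
    have h2 := hQ.mass_gen w
    rw [h1, map_smul, mass_unitVec, smul_eq_mul, mul_one] at h2
    rw [h1, h2, zero_smul]
  refine ⟨(mass w)⁻¹ • w, fun j => mul_nonneg (inv_nonneg.2 hw_mass.le) (hw_nonneg j), ?_, ?_,
    fun j hj => ?_⟩
  · rw [map_smul, smul_eq_mul, inv_mul_cancel₀ hw_mass.ne']
  · rw [map_smul, hgen, smul_zero]
  · rw [bigL_eq hQs hh hβ]
    change (mass w)⁻¹ * w j = (mass w)⁻¹ * w 0 * y j
    rw [hw0, hwj j hj, mul_one]

/-! ### The generating function of the stationary vector -/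

lemma hasSum_qMatrix_zero (hh : Summable h) {s : ℝ} (hs : |s| ≤ 1) :
    HasSum (fun j => qMatrix c b h β 0 j * s ^ j) (genH h s - hTotal h) := by
  have h1 := (hasSum_qRes_zero hh hs).add (hasSum_qCat (β := β) s 0)
  rw [pow_zero, sub_self, mul_zero, add_zero] at h1
  refine (hasSum_congr fun j => ?_).2 h1
  rw [qMatrix, qStar_zero]; ring

lemma hasSum_qMatrix_succ (hb : Summable b) {s : ℝ} (hs : |s| ≤ 1) (n : ℕ) :
    HasSum (fun j => qMatrix c b h β (n + 1) j * s ^ j)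
      (s ^ n * genBi b (min (n + 1) c) s + β * (1 - s ^ (n + 1))) := by
  refine (hasSum_congr fun j => ?_).2
    ((hasSum_qStar_succ hb hs n).add (hasSum_qCat (β := β) s (n + 1)))
  rw [qMatrix, qRes_succ]; ring

/-- Stationarity paired with `s ^ j`, multiplied by one extra `s` because row `n + 1` contributes `s
^ n`. A state `k ≥ c` contributes `s ^ k U_β(s) + βs`; the states with fewer than `c` busy servers
produce the remaining terms. -/
lemma genFun_stationary {M : ℝ} (hQ : IsBddQ (qMatrix c b h β) M) (hb : Summable b)
    (hh : Summable h) {x : L1} (hx_mass : mass x = 1) (hx : hQ.gen x = 0) {s : ℝ}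
    (hs : |s| ≤ 1) :
    genU c b β s * (genFun s hs x - x 0) + β * s * (1 - x 0) + x 0 * s * (genH h s - hTotal h) =
      ∑ k ∈ Finset.Icc 1 (c - 1), x k * ((c : ℝ) - k) * b 0 * ((1 - s) * s ^ k) := by
  have h1 := ((hasSum_map hQ.gen x).mapL (genFun s hs)).mul_left s
  rw [hx, map_zero, mul_zero] at h1
  simp only [map_smul, smul_eq_mul, hQ.gen_unitVec] at h1
  have h2 : HasSum (fun k => if k ∈ Finset.Icc 1 (c - 1) then
      x k * ((c : ℝ) - k) * b 0 * ((1 - s) * s ^ k) else 0)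
      (∑ k ∈ Finset.Icc 1 (c - 1), x k * ((c : ℝ) - k) * b 0 * ((1 - s) * s ^ k)) := by
    have h3 := hasSum_sum_of_ne_finset_zero (L := SummationFilter.unconditional ℕ)
      (s := Finset.Icc 1 (c - 1))
      (f := fun k => if k ∈ Finset.Icc 1 (c - 1) then
        x k * ((c : ℝ) - k) * b 0 * ((1 - s) * s ^ k) else 0) fun k hk => if_neg hk
    rwa [Finset.sum_congr rfl fun k hk => if_pos hk] at h3
  -- The correction at state `0`: the generic contribution `U_β(s) + βs` minus the true one `s (H(s)
  -- - h)`.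
  have h4 : HasSum (fun k : ℕ => if k = 0 then
      x 0 * (genU c b β s + β * s - s * (genH h s - hTotal h)) else 0)
      (x 0 * (genU c b β s + β * s - s * (genH h s - hTotal h))) := hasSum_ite_eq 0 _
  have h5 := ((((hasSum_genFun s hs x).mul_left (genU c b β s)).add
    ((hasSum_mass x).mul_left (β * s))).sub h4).sub h2
  have h6 := h1.unique ((hasSum_congr fun i => ?_).2 h5)
  · rw [hx_mass] at h6
    linarith
  · rcases i with _ | n
    · rw [(hasSum_genFun s hs (hQ.row 0)).unique (hasSum_qMatrix_zero hh hs)]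
      simp
      ring
    · rw [(hasSum_genFun s hs (hQ.row (n + 1))).unique (hasSum_qMatrix_succ hb hs n),
        genBi_eq (c := c)]
      by_cases hn : n + 1 ≤ c - 1
      · have h7 : min (n + 1) c = n + 1 := by omega
        simp only [h7, Finset.mem_Icc, hn, le_add_iff_nonneg_left, zero_le, and_self, if_true,
          Nat.add_eq_zero_iff, one_ne_zero, and_false, if_false, genU]
        ring
      · by_cases hc : c ≤ n + 1
        · have h7 : min (n + 1) c = c := by omega
          simp only [h7, Finset.mem_Icc, hn, and_false, if_false,
            Nat.add_eq_zero_iff, one_ne_zero, genU]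
          ring
        · omega

end Stationary

end MXMc

/-! ### The equilibrium law of the queue -/

open MXMc
theorem theorem4p4 (c : ℕ) (hc : 1 ≤ c) (b h : ℕ → ℝ) (β : ℝ)
    (hb_nonneg : ∀ j, j ≠ 1 → 0 ≤ b j) (hb_summable : Summable b)
    (hb_one : -b 1 = b 0 + ∑' j : ℕ, b (j + 2))
    (hb_zero : 0 < b 0) (hb_two : 0 < ∑' j : ℕ, b (j + 2))
    (hh_nonneg : ∀ j, 1 ≤ j → 0 ≤ h j) (hh_summable : Summable h)
    (hh_pos : 0 < hTotal h) (hβ : 0 < β) :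
    -- `u(β)` is a root of `U_β` in `(0, 1)`, and the only one on `[-1, 1]`
    (0 < rootU c b β ∧ rootU c b β < 1 ∧ genU c b β (rootU c b β) = 0 ∧
      ∀ s ∈ Set.Icc (-1 : ℝ) 1, s ≠ rootU c b β → genU c b β s ≠ 0) ∧
    ∃ π : ℕ → ℝ, IsEquilibriumDistribution (transition (qMatrix c b h β)) π ∧
      (∀ s ∈ Set.Icc (-1 : ℝ) 1, s ≠ rootU c b β →
        HasSum (fun k => π k * s ^ k)
          (π 0 * (1 + s * (genH h (rootU c b β) - genH h s) / genU c b β s) +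
            (∑ k ∈ Finset.Icc 1 (c - 1), π k * ((c : ℝ) - k) * b 0 *
              (s ^ k * (1 - s) - s * rootU c b β ^ (k - 1) * (1 - rootU c b β))) /
              genU c b β s)) ∧
      π 0 = β * (β + genH h 1 - genH h (rootU c b β) +
        ∑ k ∈ Finset.Icc 1 (c - 1), bigL c b h β k * rootU c b β ^ (k - 1) *
          ((c : ℝ) - k) * b 0 * (1 - rootU c b β))⁻¹ ∧
      ∀ j, 1 ≤ j → π j = π 0 * bigL c b h β j := by
  obtain ⟨hu0, hu1, hUu, huniq⟩ := rootU_spec hc hb_nonneg hb_summable hb_one hb_zero hβ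
  refine ⟨⟨hu0, hu1, hUu, huniq⟩, ?_⟩
  obtain ⟨x, hx_nonneg, hx_mass, hx_gen, hx_bigL⟩ :=
    exists_gen_eq_zero (c := c) hb_nonneg hb_summable hb_one hh_nonneg hh_summable hβ
  set u := rootU c b β
  have hQ' := (isBddQ_qStar (c := c) hb_nonneg hb_summable hb_one).add
    (isBddQ_qRes hh_nonneg hh_summable)
  have hgf := fun {s : ℝ} (hs : |s| ≤ 1) =>
    genFun_stationary _ hb_summable hh_summable hx_mass hx_gen hs
  -- The functional equation at the root `u`, where the unknown generating function drops out,
  -- divided by `u > 0`.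
  have hroot : β * (1 - x 0) + x 0 * (genH h u - hTotal h) =
      ∑ k ∈ Finset.Icc 1 (c - 1), x k * ((c : ℝ) - k) * b 0 * (u ^ (k - 1) * (1 - u)) := by
    have h1 := hgf (s := u) (abs_le.2 ⟨by linarith, hu1.le⟩)
    rw [hUu, zero_mul, zero_add] at h1
    refine mul_left_cancel₀ hu0.ne' ?_
    rw [Finset.mul_sum]
    refine Eq.trans (by ring) (h1.trans (Finset.sum_congr rfl fun k hk => ?_))
    obtain ⟨k, rfl⟩ := Nat.exists_eq_add_of_le' (Finset.mem_Icc.1 hk).1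
    rw [Nat.add_sub_cancel]
    ring
  refine ⟨fun j => x j, IsBddQ.isEquilibriumDistribution _ hQ' hβ qMatrix_eq hx_nonneg hx_mass
    hx_gen, fun s hs hsu => ?_, ?_, hx_bigL⟩
  · have hU := huniq s hs hsu
    have h1 := hgf (abs_le.2 hs)
    convert hasSum_genFun s (abs_le.2 hs) x using 1
    have h2 : ∑ k ∈ Finset.Icc 1 (c - 1), x k * ((c : ℝ) - k) * b 0 *
        (s ^ k * (1 - s) - s * u ^ (k - 1) * (1 - u)) =
        ∑ k ∈ Finset.Icc 1 (c - 1), x k * ((c : ℝ) - k) * b 0 * ((1 - s) * s ^ k) -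
        s * ∑ k ∈ Finset.Icc 1 (c - 1), x k * ((c : ℝ) - k) * b 0 * (u ^ (k - 1) * (1 - u)) := by
      rw [Finset.mul_sum, ← Finset.sum_sub_distrib]
      exact Finset.sum_congr rfl fun k _ => by ring
    -- The boundary sum in the statement is the one at `s` minus `s` times the one at `u`; both are
    -- now explicit in `x 0` and `Π(s)`.
    rw [h2, ← h1, ← hroot]
    field_simp
    ring
  · have h1 : x 0 * (β + genH h 1 - genH h u + ∑ k ∈ Finset.Icc 1 (c - 1),
        bigL c b h β k * u ^ (k - 1) * ((c : ℝ) - k) * b 0 * (1 - u)) = β := by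
      have h2 : x 0 * ∑ k ∈ Finset.Icc 1 (c - 1),
          bigL c b h β k * u ^ (k - 1) * ((c : ℝ) - k) * b 0 * (1 - u) =
          ∑ k ∈ Finset.Icc 1 (c - 1), x k * ((c : ℝ) - k) * b 0 * (u ^ (k - 1) * (1 - u)) := by
        rw [Finset.mul_sum]
        refine Finset.sum_congr rfl fun k hk => ?_
        rw [hx_bigL k (Finset.mem_Icc.1 hk).1]
        ring
      rw [mul_add, h2, ← hroot, genH_one]
      ring
    -- The bracket is nonzero because its product with `x 0` is `β > 0`.
    exact (eq_mul_inv_iff_mul_eq₀ (right_ne_zero_of_mul (h1.trans_ne hβ.ne'))).2 h1
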